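/- Let $p>3$ be a prime with $p\equiv3\pmod4$ and put $m=(p-1)/2$. Let $T_p=(t_{ij})_{1\le i,j\le m}$ be the $m\times m$ matrix over $\mathbb Q$ with $$t_{ij}=\begin{cases}0,& i=j,\\ \dfrac{i^2+j^2}{i^2-j^2},& i\neq j,\end{cases}$$ and let $I_m$ be the $m\times m$ identity matrix. Then, with congruences taken in the ring $\mathbb Z_p$ of $p$-adic integers (so that $x\equiv y\pmod{p^k}$ means $x,y\in\mathbb Z_p$ and $x-y\in p^k\mathbb Z_p$), $$\det(I_m+T_p)\equiv0\pmod{p^2}.$$ If moreover $p\equiv7\pmod8$, then $$\det(I_m+T_p)\equiv0\pmod{p^3}.$$ -/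

import Mathlib

/-- Congruence modulo `p ^ k` in `ℤ_p` for rational numbers: both `x` and `y` are `p`-adic integers
and their difference is divisible by `p ^ k` in `ℤ_p`. -/
def PadicModEq (p : ℕ) [Fact p.Prime] (k : ℕ) (x y : ℚ) : Prop :=
  ∃ a b : ℤ_[p], (a : ℚ_[p]) = (x : ℚ_[p]) ∧ (b : ℚ_[p]) = (y : ℚ_[p]) ∧
    (p : ℤ_[p]) ^ k ∣ a - b

/-- The matrix `T_p` of size `m = (p - 1) / 2`, with entries `0` on the diagonal and
`(i ^ 2 + j ^ 2) / (i ^ 2 - j ^ 2)` off the diagonal, for `1 ≤ i, j ≤ m`. The index `i : Fin m`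
stands for the integer `i + 1`. -/
def halfCayleyMatrix (p : ℕ) : Matrix (Fin ((p - 1) / 2)) (Fin ((p - 1) / 2)) ℚ :=
  Matrix.of fun i j =>
    if i = j then 0
    else (((i : ℕ) + 1 : ℚ) ^ 2 + ((j : ℕ) + 1 : ℚ) ^ 2) /
      (((i : ℕ) + 1 : ℚ) ^ 2 - ((j : ℕ) + 1 : ℚ) ^ 2)

/-! Put x_i = i^2, P = ∏ (X - x_i), A = I + T_p; the entries of A are p-adic integers. If an
integral vector u has a unit coordinate and A u ≡ 0 mod p^k, then det(A) u = adj(A) A u gives p^k ∣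
det A. Such u are sought in the form u_i = h(x_i) / (x_i P'(x_i)) with h(0) = 0 and deg h ≤ m.
Partial fractions (`Lagrange.sum_cayley_mul`) turn A u, up to the factor P'(x_i)^2, into the values
at the nodes of L(h) = 2h'P' - hP'' - h_m P'^2, where h_m is the coefficient of X^m.

Modulo p, P is X^m - 1, and m = 2a + 1 is odd because p ≡ 3 mod 4. At a root y of X^m - 1, y^2 L
sends X^j (j < m) to 2m(j - a) y^j and X^m to the constant m. So it kills X^a, and X^a is the only
power it misses. Write P = X^m - 1 + p ∑ r_l X^l and start from h = 2m X^a. The error of order p is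
removed by `firstCorrection`, which gives p^2. The error of order p^2 can be removed once its y^a
coefficient vanishes mod p. In that coefficient the products r_l r_(m-l) cancel pair by pair, and
what remains is a multiple of r_a (`second_order_mem_solvableModulo`).

If p ≡ 7 mod 8, then p ∣ r_a (`dvd_middle_coeff`): summing x^(a+1) (1 - x^m) over the nodes gives p
m r_a mod p^2, and also a difference of two half-range power sums, each divisible by p^2 because 2
is a square mod p. -/

open Polynomial

/-! ### Partial fractions and the Cayley matrix -/

theorem Lagrange.eval_derivative_nodal_erase_self {K ι : Type*} [Field K] [Fintype ι]
    [DecidableEq ι] (x : ι → K) (i : ι) :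
    2 * (derivative (Lagrange.nodal (Finset.univ.erase i) x)).eval (x i) =
      (derivative (derivative (Lagrange.nodal Finset.univ x))).eval (x i) := by
  rw [Lagrange.nodal_eq_mul_nodal_erase (Finset.mem_univ i)]
  simp only [derivative_mul, derivative_sub, derivative_X, derivative_C, derivative_add,
    derivative_one, eval_add, eval_mul, eval_sub, eval_X, eval_C, eval_one, eval_zero,
    sub_zero]
  ring

theorem Lagrange.sub_mul_eval_derivative_nodal_erase {K ι : Type*} [Field K] [Fintype ι]
    [DecidableEq ι] (x : ι → K) {i j : ι} (hij : i ≠ j) :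
    (x i - x j) * (derivative (Lagrange.nodal (Finset.univ.erase j) x)).eval (x i) =
      (derivative (Lagrange.nodal Finset.univ x)).eval (x i) := by
  have h0 : (Lagrange.nodal (Finset.univ.erase j) x).eval (x i) = 0 :=
    Lagrange.eval_nodal_at_node (by simp [hij])
  rw [Lagrange.nodal_eq_mul_nodal_erase (Finset.mem_univ j)]
  simp [derivative_mul, h0]

theorem Lagrange.eval_derivative_nodal_ne_zero {K ι : Type*} [Field K] [Fintype ι]
    [DecidableEq ι] {x : ι → K} (hx : Function.Injective x) (i : ι) :
    (derivative (Lagrange.nodal Finset.univ x)).eval (x i) ≠ 0 := by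
  rw [Lagrange.eval_nodal_derivative_eval_node_eq (Finset.mem_univ i), Lagrange.eval_nodal]
  exact Finset.prod_ne_zero_iff.mpr fun j hj =>
    sub_ne_zero.mpr fun h => (Finset.ne_of_mem_erase hj) (hx h).symm

/-- Partial fractions for a polynomial whose degree is at most the number of nodes. -/
theorem Lagrange.eq_nodal_add_sum {K ι : Type*} [Field K] [Fintype ι] [DecidableEq ι]
    {x : ι → K} (hx : Function.Injective x) {h : K[X]} (hdeg : h.natDegree ≤ Fintype.card ι) :
    h = C (h.coeff (Fintype.card ι)) * Lagrange.nodal Finset.univ x +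
      ∑ j, C (h.eval (x j) / (derivative (Lagrange.nodal Finset.univ x)).eval (x j)) *
        Lagrange.nodal (Finset.univ.erase j) x := by
  classical
  set n := Fintype.card ι
  have hn : (Lagrange.nodal Finset.univ x).natDegree = n := Lagrange.natDegree_nodal
  have hmon : (Lagrange.nodal Finset.univ x).Monic := Lagrange.nodal_monic
  rw [← sub_eq_iff_eq_add']
  have hdeg1 : (h - C (h.coeff n) * Lagrange.nodal Finset.univ x).degree < n := by
    rw [degree_lt_iff_coeff_zero]
    intro k hk
    rcases hk.eq_or_lt with rfl | hk
    · have : (Lagrange.nodal Finset.univ x).coeff n = 1 := by rw [← hn]; exact hmon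
      simp [this]
    · rw [coeff_sub, coeff_C_mul, coeff_eq_zero_of_natDegree_lt (hdeg.trans_lt hk),
        coeff_eq_zero_of_natDegree_lt (hn.trans_lt hk)]
      simp
  refine eq_of_degrees_lt_of_eval_finset_eq (Finset.univ.image x) ?_ ?_ ?_
  · rwa [Finset.card_image_of_injective _ hx, Finset.card_univ]
  · rw [Finset.card_image_of_injective _ hx, Finset.card_univ]
    refine (degree_sum_le _ _).trans_lt ((Finset.sup_lt_iff (WithBot.bot_lt_coe _)).mpr ?_)
    intro j _
    refine (smul_eq_C_mul (_ : K) ▸ degree_smul_le _ _).trans_lt ?_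
    rw [Lagrange.degree_nodal]
    exact_mod_cast Finset.card_lt_card (Finset.erase_ssubset (Finset.mem_univ j))
  · intro y hy
    obtain ⟨i, -, rfl⟩ := Finset.mem_image.mp hy
    have h0 : (Lagrange.nodal Finset.univ x).eval (x i) = 0 :=
      Lagrange.eval_nodal_at_node (Finset.mem_univ i)
    rw [eval_finsetSum, Finset.sum_eq_single i]
    · simp only [eval_sub, eval_mul, eval_C, h0, mul_zero, sub_zero]
      have h1 := Lagrange.eval_derivative_nodal_ne_zero hx i
      rw [← Lagrange.eval_nodal_derivative_eval_node_eq (Finset.mem_univ i), div_mul_cancel₀ _ h1]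
    · intro j _ hj
      rw [eval_mul, Lagrange.eval_nodal_at_node (by simp [hj.symm]), mul_zero]
    · simp

/-- The action of the matrix with entries `(x i + x j) / (x i - x j)` and unit diagonal, expressed
through the polynomial that interpolates the (rescaled) vector. -/
theorem Lagrange.sum_cayley_mul {K ι : Type*} [Field K] [Fintype ι] [DecidableEq ι]
    {x : ι → K} (hx : Function.Injective x) (hx0 : ∀ i, x i ≠ 0) {h : K[X]}
    (hdeg : h.natDegree ≤ Fintype.card ι) (h0 : h.eval 0 = 0) {A : Matrix ι ι K} {u : ι → K}
    (hA1 : ∀ i, A i i = 1) (hA : ∀ i j, i ≠ j → A i j * (x i - x j) = x i + x j)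
    (hu : ∀ i, u i * (x i * (derivative (Lagrange.nodal Finset.univ x)).eval (x i)) = h.eval (x i))
    (i : ι) :
    (derivative (Lagrange.nodal Finset.univ x)).eval (x i) ^ 2 * (A.mulVec u) i =
      2 * (derivative h).eval (x i) * (derivative (Lagrange.nodal Finset.univ x)).eval (x i) -
        h.eval (x i) * (derivative (derivative (Lagrange.nodal Finset.univ x))).eval (x i) -
        h.coeff (Fintype.card ι) * (derivative (Lagrange.nodal Finset.univ x)).eval (x i) ^ 2 := by
  have hd := Lagrange.eval_derivative_nodal_ne_zero hx
  have hc : ∀ j, h.eval (x j) / (derivative (Lagrange.nodal Finset.univ x)).eval (x j) =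
      x j * u j := fun j => by
    rw [← hu, div_eq_iff (hd j)]; ring
  have key := Lagrange.eq_nodal_add_sum hx hdeg
  simp only [hc] at key
  set c := h.coeff (Fintype.card ι)
  have hP0 : (Lagrange.nodal Finset.univ x).eval 0 ≠ 0 := by
    rw [Lagrange.eval_nodal]
    exact Finset.prod_ne_zero_iff.mpr fun j _ => by simpa using hx0 j
  -- Evaluate the partial fractions at 0, where h vanishes and P does not.
  have hsum : ∑ j, u j = c := by
    have h1 := congrArg (eval 0) key
    have h2 : ∀ j, x j * u j * (Lagrange.nodal (Finset.univ.erase j) x).eval 0 =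
        -(u j * (Lagrange.nodal Finset.univ x).eval 0) := fun j => by
      rw [Lagrange.nodal_eq_mul_nodal_erase (Finset.mem_univ j)]
      simp only [eval_mul, eval_sub, eval_X, eval_C]
      ring
    simp only [h0, eval_add, eval_mul, eval_C, eval_finsetSum, h2, Finset.sum_neg_distrib,
      ← Finset.sum_mul] at h1
    have h3 : (c - ∑ j, u j) * (Lagrange.nodal Finset.univ x).eval 0 = 0 := by
      linear_combination -h1
    rcases mul_eq_zero.mp h3 with h | h
    · exact (sub_eq_zero.mp h).symm
    · exact absurd h hP0
  set P1 := (derivative (Lagrange.nodal Finset.univ x)).eval (x i)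
  set P2 := (derivative (derivative (Lagrange.nodal Finset.univ x))).eval (x i)
  have hder : (derivative h).eval (x i) = c * P1 + ∑ j, x j * u j *
      (derivative (Lagrange.nodal (Finset.univ.erase j) x)).eval (x i) := by
    have h1 := congrArg (fun q => (derivative q).eval (x i)) key
    simpa [eval_finsetSum] using h1
  -- Off the diagonal, (x_i + x_j)/(x_i - x_j) = 1 + 2 x_j/(x_i - x_j). The diagonal entry is just
  -- 1, so the j = i term of h', which carries P''/2, is subtracted again.
  have hterm : ∀ j, P1 * (A i j * u j) = P1 * u j + 2 * (x j * u j *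
      (derivative (Lagrange.nodal (Finset.univ.erase j) x)).eval (x i)) -
      if j = i then x i * u i * P2 else 0 := fun j => by
    by_cases hij : j = i
    · subst hij
      have := Lagrange.eval_derivative_nodal_erase_self x j
      rw [hA1, if_pos rfl]
      linear_combination -(x j * u j) * this
    · have h1 := Lagrange.sub_mul_eval_derivative_nodal_erase x (Ne.symm hij)
      have h2 := hA i j (Ne.symm hij)
      have h3 : x i - x j ≠ 0 := sub_ne_zero.mpr fun h => hij (hx h).symm
      rw [if_neg hij]
      apply mul_left_cancel₀ h3
      linear_combination P1 * u j * h2 - 2 * x j * u j * h1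
  have hmv : P1 * (A.mulVec u) i = P1 * c + 2 * ((derivative h).eval (x i) - c * P1) -
      x i * u i * P2 := by
    rw [hder, Matrix.mulVec, dotProduct, Finset.mul_sum, Finset.sum_congr rfl fun j _ => hterm j,
      Finset.sum_sub_distrib, Finset.sum_add_distrib, ← Finset.mul_sum, ← Finset.mul_sum, hsum]
    simp
  rw [← hu i]
  linear_combination P1 * hmv

/-- An integral vector, almost annihilated by a matrix of Cayley type, bounds the divisibility of
the determinant. -/
theorem dvd_det_of_dvd_interpolation {O ι : Type*} [CommRing O] [IsDomain O] [Fintype ι]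
    [DecidableEq ι] {x : ι → O} (hx0 : ∀ i, IsUnit (x i))
    (hx : ∀ i j, i ≠ j → IsUnit (x i - x j)) {h : O[X]}
    (hdeg : h.natDegree ≤ Fintype.card ι) (h0 : h.eval 0 = 0) {A : Matrix ι ι O}
    (hA1 : ∀ i, A i i = 1) (hA : ∀ i j, i ≠ j → A i j * (x i - x j) = x i + x j) {d : O}
    (hd : ∀ i, d ∣ x i ^ 2 * (2 * (derivative h).eval (x i) *
        (derivative (Lagrange.nodal Finset.univ x)).eval (x i) -
        h.eval (x i) * (derivative (derivative (Lagrange.nodal Finset.univ x))).eval (x i) -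
        h.coeff (Fintype.card ι) * (derivative (Lagrange.nodal Finset.univ x)).eval (x i) ^ 2))
    {i₀ : ι} (hi₀ : IsUnit (h.eval (x i₀))) : d ∣ A.det := by
  set P := Lagrange.nodal Finset.univ x with hP
  have hinj : Function.Injective x := fun i j hij => by
    by_contra hne
    exact (hx i j hne).ne_zero (sub_eq_zero.mpr hij)
  have hPu : ∀ i, IsUnit ((derivative P).eval (x i)) := fun i => by
    have : (derivative P).eval (x i) = ∏ j ∈ Finset.univ.erase i, (x i - x j) := by
      rw [hP, Lagrange.eval_nodal_derivative_eval_node_eq (Finset.mem_univ i), Lagrange.eval_nodal]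
    rw [this]
    exact IsUnit.prod_iff.mpr fun j hj => hx i j (Finset.ne_of_mem_erase hj).symm
  choose w hw using fun i => ((hx0 i).mul (hPu i)).exists_left_inv
  set u : ι → O := fun i => h.eval (x i) * w i
  -- The interpolation identity needs a field; it is proved over K and pulled back by injectivity.
  let K := FractionRing O
  let φ : O →+* K := algebraMap O K
  have hφ : Function.Injective φ := IsFractionRing.injective O K
  have hPK : Lagrange.nodal Finset.univ (fun i => φ (x i)) = P.map φ := by
    simp [hP, Lagrange.nodal, Polynomial.map_prod]
  have key : ∀ i, (derivative P).eval (x i) ^ 2 * (A.mulVec u) i =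
      2 * (derivative h).eval (x i) * (derivative P).eval (x i) -
        h.eval (x i) * (derivative (derivative P)).eval (x i) -
        h.coeff (Fintype.card ι) * (derivative P).eval (x i) ^ 2 := fun i => by
    have := Lagrange.sum_cayley_mul (x := fun i => φ (x i)) (h := h.map φ) (A := A.map φ)
      (u := fun i => φ (u i)) (hφ.comp hinj) (fun i => by
        simpa using (map_ne_zero_iff φ hφ).mpr (hx0 i).ne_zero)
      ((natDegree_map_le).trans hdeg) (by rw [← map_zero φ, eval_map_apply, h0])
      (fun i => by simp [hA1]) (fun i j hij => by
        simp only [Matrix.map_apply, ← map_sub, ← map_mul, ← map_add, hA i j hij])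
      (fun i => by
        simp only [hPK, derivative_map, eval_map_apply, ← map_mul]
        congr 1
        simp only [u]
        linear_combination h.eval (x i) * hw i) i
    apply hφ
    have hmv : ((A.map φ).mulVec fun i => φ (u i)) i = φ (A.mulVec u i) :=
      (RingHom.map_mulVec φ A u i).symm
    simp only [hPK, derivative_map, eval_map_apply, hmv, coeff_map] at this
    simpa only [map_sub, map_mul, map_pow, map_ofNat] using this
  have hAu : ∀ i, d ∣ (A.mulVec u) i := fun i => by
    have h1 := hd i
    rw [← key i, ← mul_assoc] at h1
    exact (((hx0 i).pow 2).mul ((hPu i).pow 2)).dvd_mul_left.mp h1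
  have hdet : A.det * u i₀ = A.adjugate.mulVec (A.mulVec u) i₀ := by
    rw [Matrix.mulVec_mulVec, Matrix.adjugate_mul, Matrix.smul_mulVec, Matrix.one_mulVec]
    rfl
  have hu : IsUnit (u i₀) := hi₀.mul (IsUnit.of_mul_eq_one _ (hw i₀))
  refine hu.dvd_mul_right.mp (hdet ▸ Finset.dvd_sum fun j _ => Dvd.dvd.mul_left (hAu j) _)

/-! ### The leading operator modulo π and its cokernel -/

/-- The pairs `(f, c)` such that, on the nodes `x`, the function `f - c * x ^ a` is congruent to a
value of the leading part `∑ 2 m (j - a) b_j x ^ j + m b_m` of the Cayley operator, `m = 2 a + 1`. -/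
def solvableModulo {O ι : Type*} [CommRing O] (π : O) (a : ℕ) (x : ι → O) :
    Submodule O ((ι → O) × O) where
  carrier := {f | ∃ b : ℕ → O, b 0 = 0 ∧ ∀ i, π ∣ f.1 i +
    (∑ j ∈ Finset.range (2 * a + 1), 2 * (2 * a + 1) * ((j : O) - a) * b j * x i ^ j +
      (2 * a + 1) * b (2 * a + 1)) - f.2 * x i ^ a}
  add_mem' := by
    rintro f g ⟨b, hb0, hb⟩ ⟨c, hc0, hc⟩
    refine ⟨b + c, by simp [hb0, hc0], fun i => ?_⟩
    convert dvd_add (hb i) (hc i) using 1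
    simp only [Prod.fst_add, Prod.snd_add, Pi.add_apply, mul_add, add_mul, Finset.sum_add_distrib]
    ring
  zero_mem' := ⟨0, by simp⟩
  smul_mem' := by
    rintro t f ⟨b, hb0, hb⟩
    refine ⟨t • b, by simp [hb0], fun i => ?_⟩
    convert (hb i).mul_left t using 1
    simp only [Prod.smul_fst, Prod.smul_snd, Pi.smul_apply, smul_eq_mul, mul_add, mul_sub,
      Finset.mul_sum]
    congr 1
    · congr 1
      congr 1
      · exact Finset.sum_congr rfl fun j _ => by ring
      · ring
    · ring

section

variable {O ι : Type*} [CommRing O] {π : O} {a : ℕ} {x : ι → O}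

/-- Exponents matter only mod m, since x^m ≡ 1. The operator is diagonal on monomials with
eigenvalues 2m(k - a), which are units for k ≠ a. -/
theorem pow_mem_solvableModulo (hu : ∀ k : ℕ, 0 < k → k ≤ 2 * a + 1 → IsUnit (k : O))
    (ha : 0 < a) (hx : ∀ i, π ∣ x i ^ (2 * a + 1) - 1) (n : ℕ) :
    ((fun i => x i ^ n, if n % (2 * a + 1) = a then 1 else 0) : (ι → O) × O) ∈
      solvableModulo π a x := by
  set m := 2 * a + 1 with hm
  have hmO : (2 * (a : O) + 1) = (m : O) := by simp [hm]
  have hred : ∀ i, π ∣ x i ^ n - x i ^ (n % m) := fun i => by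
    have h1 : x i ^ n = x i ^ (n % m) * (x i ^ m) ^ (n / m) := by
      rw [← pow_mul, ← pow_add, Nat.mod_add_div]
    have h2 : π ∣ (x i ^ m) ^ (n / m) - 1 := by
      have := sub_dvd_pow_sub_pow (x i ^ m) 1 (n / m)
      rw [one_pow] at this
      exact (hx i).trans this
    rw [h1]
    convert h2.mul_left (x i ^ (n % m)) using 1
    ring
  have hlt : n % m < m := Nat.mod_lt _ (by omega)
  set k := n % m
  obtain ⟨m', hm'⟩ := (hu m (by omega) le_rfl).exists_right_inv
  by_cases hk : k = a
  · refine ⟨0, by simp, fun i => ?_⟩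
    simpa [hk] using hred i
  by_cases hk0 : k = 0
  -- As b 0 = 0 is imposed, the constant must come from the X^m coefficient, whose image is the
  -- constant m.
  · refine ⟨fun j => if j = m then -m' else 0, by simp [hm], fun i => ?_⟩
    have : ∀ j ∈ Finset.range m, 2 * (2 * (a : O) + 1) * ((j : O) - a) *
        (if j = m then -m' else 0) * x i ^ j = 0 := fun j hj => by
      rw [if_neg (Finset.mem_range.mp hj).ne]; ring
    simp only [← hm, hmO] at this ⊢
    simp only [Finset.sum_eq_zero this, if_neg hk, if_true]
    convert hred i using 1
    rw [hk0]
    linear_combination -hm'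
  · have hkk : IsUnit (2 * ((k : O) - a)) := by
      refine IsUnit.mul (by exact_mod_cast hu 2 (by omega) (by omega)) ?_
      rcases lt_or_gt_of_ne hk with h | h
      · have := hu (a - k) (by omega) (by omega)
        rw [Nat.cast_sub h.le] at this
        rw [← neg_sub]; exact this.neg
      · have := hu (k - a) (by omega) (by omega)
        rwa [Nat.cast_sub h.le] at this
    obtain ⟨v, hv⟩ := hkk.exists_right_inv
    refine ⟨fun j => if j = k then -(m' * v) else 0, by simp [Ne.symm hk0], fun i => ?_⟩
    have : ∀ j : ℕ, 2 * (2 * (a : O) + 1) * ((j : O) - a) *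
        (if j = k then -(m' * v) else 0) * x i ^ j = if j = k then -x i ^ k else 0 := fun j => by
      split_ifs with h
      · rw [h, hmO]
        linear_combination (-x i ^ k) * hv - x i ^ k * 2 * (k - a) * v * hm'
      · ring
    simp only [← hm, this, Finset.sum_ite_eq', Finset.mem_range, hlt, if_true, if_neg hk,
      if_neg hlt.ne']
    convert hred i using 1
    ring

/-- Only the index l₀ brings x^j x^l to the exponent a mod m, so γ l₀ is the whole obstruction. -/
theorem pow_mul_sum_mem_solvableModulo
    (hu : ∀ k : ℕ, 0 < k → k ≤ 2 * a + 1 → IsUnit (k : O))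
    (ha : 0 < a) (hx : ∀ i, π ∣ x i ^ (2 * a + 1) - 1) (γ : ℕ → O) {j l₀ : ℕ}
    (hl₀ : l₀ < 2 * a + 1) (hj : j + l₀ = a ∨ j + l₀ = a + (2 * a + 1)) :
    ((fun i => x i ^ j * ∑ l ∈ Finset.range (2 * a + 1), γ l * x i ^ l, γ l₀) : (ι → O) × O) ∈
      solvableModulo π a x := by
  have h := Submodule.sum_mem (solvableModulo π a x) (t := Finset.range (2 * a + 1))
    fun l _ => Submodule.smul_mem _ (γ l) (pow_mem_solvableModulo hu ha hx (j + l))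
  have hiff : ∀ l ∈ Finset.range (2 * a + 1), ((j + l) % (2 * a + 1) = a ↔ l = l₀) := by
    intro l hl
    have hl := Finset.mem_range.mp hl
    have h1 : (j + l₀) % (2 * a + 1) = a % (2 * a + 1) := by
      rcases hj with h | h <;> rw [h]
      simp
    have h2 : a % (2 * a + 1) = a := Nat.mod_eq_of_lt (by omega)
    constructor
    · intro h3
      have h4 : j + l ≡ j + l₀ [MOD 2 * a + 1] := by
        unfold Nat.ModEq; omega
      have := Nat.ModEq.add_left_cancel' j h4
      exact this.eq_of_lt_of_lt hl hl₀
    · rintro rfl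
      omega
  convert h using 1
  ext i
  · simp only [Prod.fst_sum, Prod.smul_fst, Finset.sum_apply, Pi.smul_apply, smul_eq_mul,
      Finset.mul_sum]
    exact Finset.sum_congr rfl fun l _ => by ring
  · simp only [Prod.snd_sum, Prod.smul_snd, smul_eq_mul]
    rw [Finset.sum_congr rfl fun l hl => by rw [if_congr (hiff l hl) rfl rfl]]
    simp [hl₀]

/-! ### The first-order correction -/

/-- The first-order correction to `2 m X ^ a`, where `m = 2 a + 1`, for the nodes that are the
roots of `X ^ m - 1 + π ∑ r_l X ^ l`. -/
noncomputable def firstCorrection (a : ℕ) (r : ℕ → O) : O[X] :=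
  ∑ l ∈ Finset.Icc 1 a, (C ((2 * a + 1 - l) * r (2 * a + 1 - l)) * X ^ (a - l) -
    C ((2 * a + 1 - l) * r l) * X ^ (a + l)) -
    C ((a + 1) * r (a + 1)) - C (2 * a * (a + 1) * r (a + 1)) * X ^ (2 * a + 1)

theorem eval_firstCorrection (a : ℕ) (r : ℕ → O) (y : O) :
    (firstCorrection a r).eval y =
      ∑ l ∈ Finset.Icc 1 a, ((2 * a + 1 - l) * r (2 * a + 1 - l) * y ^ (a - l) -
        (2 * a + 1 - l) * r l * y ^ (a + l)) -
      (a + 1) * r (a + 1) - 2 * a * (a + 1) * r (a + 1) * y ^ (2 * a + 1) := by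
  simp only [firstCorrection, eval_sub, eval_finsetSum, eval_mul, eval_C, eval_pow, eval_X]

theorem mul_eval_derivative_C_mul_X_pow (c y : O) (n : ℕ) :
    y * (derivative (C c * X ^ n)).eval y = n * c * y ^ n := by
  cases n with
  | zero => simp
  | succ n =>
    simp only [derivative_C_mul_X_pow, eval_mul, eval_C, eval_pow, eval_X, Nat.add_sub_cancel]
    ring

theorem mul_eval_derivative_firstCorrection (a : ℕ) (r : ℕ → O) (y : O) :
    y * (derivative (firstCorrection a r)).eval y =
      ∑ l ∈ Finset.Icc 1 a, ((a - l) * (2 * a + 1 - l) * r (2 * a + 1 - l) * y ^ (a - l) -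
        (a + l) * (2 * a + 1 - l) * r l * y ^ (a + l)) -
      (2 * a + 1) * (2 * a * (a + 1) * r (a + 1)) * y ^ (2 * a + 1) := by
  rw [firstCorrection]
  simp only [derivative_sub, derivative_sum, eval_sub, eval_finsetSum, mul_sub,
    Finset.mul_sum, mul_eval_derivative_C_mul_X_pow, derivative_C, eval_zero]
  push_cast
  rw [mul_zero, sub_zero]
  congr 1
  refine Finset.sum_congr rfl fun l hl => ?_
  rw [Nat.cast_sub (Finset.mem_Icc.mp hl).2]
  ring

theorem eval_zero_firstCorrection (ha : 0 < a) (r : ℕ → O) :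
    (firstCorrection a r).eval 0 = 0 := by
  rw [eval_firstCorrection, Finset.sum_eq_single a]
  -- The l = a term has exponent a - l = 0; the separate constant in the definition is there to
  -- cancel it.
  · have h1 : 2 * a + 1 - a = a + 1 := by omega
    have h2 : (0 : O) ^ (a + a) = 0 := zero_pow (by omega)
    have h3 : (0 : O) ^ (2 * a + 1) = 0 := zero_pow (by omega)
    rw [h1, h2, h3, Nat.sub_self]
    ring
  · intro l hl hla
    have := Finset.mem_Icc.mp hl
    rw [zero_pow (by omega), zero_pow (by omega)]
    ring
  · intro h
    exact absurd (Finset.mem_Icc.mpr ⟨ha, le_rfl⟩) h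

/-- Adding the top term back leaves only exponents up to 2a; this gives both the degree and the
coefficient of X^m. -/
theorem natDegree_firstCorrection_add_le (a : ℕ) (r : ℕ → O) :
    (firstCorrection a r + C (2 * a * (a + 1) * r (a + 1)) * X ^ (2 * a + 1)).natDegree ≤
      2 * a := by
  rw [firstCorrection, sub_add_cancel]
  refine (natDegree_sub_le _ _).trans (max_le ?_ ((natDegree_C _).trans_le (Nat.zero_le _)))
  refine natDegree_sum_le_of_forall_le _ _ fun l hl => ?_
  have := Finset.mem_Icc.mp hl
  exact (natDegree_sub_le _ _).trans (max_le ((natDegree_C_mul_X_pow_le _ _).trans (by omega))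
    ((natDegree_C_mul_X_pow_le _ _).trans (by omega)))

theorem natDegree_firstCorrection_le (a : ℕ) (r : ℕ → O) :
    (firstCorrection a r).natDegree ≤ 2 * a + 1 := by
  have h := natDegree_firstCorrection_add_le a r
  rw [← add_sub_cancel_right (firstCorrection a r)
    (C (2 * a * (a + 1) * r (a + 1)) * X ^ (2 * a + 1))]
  exact (natDegree_sub_le _ _).trans (max_le (h.trans (by omega)) (natDegree_C_mul_X_pow_le _ _))

theorem coeff_firstCorrection (a : ℕ) (r : ℕ → O) :
    (firstCorrection a r).coeff (2 * a + 1) = -(2 * a * (a + 1) * r (a + 1)) := by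
  have h := coeff_eq_zero_of_natDegree_lt
    ((natDegree_firstCorrection_add_le a r).trans_lt (Nat.lt_succ_self _))
  rw [coeff_add, coeff_C_mul_X_pow, if_pos rfl] at h
  exact eq_neg_of_add_eq_zero_left h

end

/-- The pairing of l with m - l behind every cancellation below. -/
theorem sum_range_two_mul_add_one {O : Type*} [AddCommMonoid O] (a : ℕ) (f : ℕ → O) :
    ∑ l ∈ Finset.range (2 * a + 1), f l =
      f 0 + ∑ l ∈ Finset.Icc 1 a, (f l + f (2 * a + 1 - l)) := by
  rw [Finset.range_eq_Ico, Finset.sum_eq_sum_Ico_succ_bot (by omega), Finset.sum_add_distrib,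
    ← Finset.sum_Ico_consecutive f (show 0 + 1 ≤ a + 1 by omega) (by omega)]
  congr 2
  refine Finset.sum_nbij' (fun l => 2 * a + 1 - l) (fun l => 2 * a + 1 - l) ?_ ?_ ?_ ?_ ?_ <;>
    intro l hl <;> simp only [Finset.mem_Ico, Finset.mem_Icc] at hl ⊢
  · omega
  · omega
  · omega
  · omega
  · congr 1; omega

/-! ### Expansion of the operator in powers of π -/

section

variable {O ι : Type*} [CommRing O] {π : O} {a : ℕ}

/-- Expansion in powers of `π` of the Cayley operator applied to
`2 m X ^ a + π * firstCorrection a r + π ^ 2 * g`, evaluated at a node `y`. The term of order `0`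
vanishes, and that of order `1` is a multiple of `1 - y ^ m`, hence divisible by `π`. -/
theorem cayley_operator_expansion (r : ℕ → O) {g h P : O[X]} {y : O}
    (hP : P = X ^ (2 * a + 1) - 1 + C π * ∑ l ∈ Finset.range (2 * a + 1), C (r l) * X ^ l)
    (hh : h = C (2 * (2 * (a : O) + 1)) * X ^ a + C π * firstCorrection a r + C (π ^ 2) * g)
    (ha : 0 < a) (hy : P.eval y = 0) :
    π ^ 3 ∣ y ^ 2 * (2 * (derivative h).eval y * (derivative P).eval y -
        h.eval y *
          (derivative (derivative P)).eval y -
        h.coeff (2 * a + 1)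
          * (derivative P).eval y ^ 2) -
      π ^ 2 * (
        (2 * (2 * a + 1) * (∑ l ∈ Finset.Icc 1 a, l * (2 * a + 1 - l) * r l * y ^ (a + l) +
            a * (a + 1) * r (a + 1) * y ^ (2 * a + 1)) *
          ∑ l ∈ Finset.range (2 * a + 1), r l * y ^ l +
        2 * (y * (derivative (firstCorrection a r)).eval y) *
          ∑ l ∈ Finset.range (2 * a + 1), l * r l * y ^ l -
        (firstCorrection a r).eval y *
          ∑ l ∈ Finset.range (2 * a + 1), l * (l - 1) * r l * y ^ l +
        4 * a * (a + 1) * r (a + 1) * (2 * a + 1) * (y ^ (2 * a + 1) *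
          ∑ l ∈ Finset.range (2 * a + 1), l * r l * y ^ l)) +
        (2 * a + 1) * (2 * (y * (derivative g).eval y) - 2 * a * g.eval y) * y ^ (2 * a + 1) -
        g.coeff (2 * a + 1) * (2 * a + 1) ^ 2 * (y ^ (2 * a + 1)) ^ 2) := by
  set ρ0 := ∑ l ∈ Finset.range (2 * a + 1), r l * y ^ l with hρ0
  set ρ1 := ∑ l ∈ Finset.range (2 * a + 1), (l : O) * r l * y ^ l with hρ1
  set ρ2 := ∑ l ∈ Finset.range (2 * a + 1), (l : O) * (l - 1) * r l * y ^ l with hρ2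
  set A := ∑ l ∈ Finset.Icc 1 a, (l : O) * (2 * a + 1 - l) * r l * y ^ (a + l) with hA
  have hθP : y * (derivative P).eval y = (2 * a + 1) * y ^ (2 * a + 1) + π * ρ1 := by
    have h1 : y * (derivative (X ^ (2 * a + 1) : O[X])).eval y =
        (2 * a + 1) * y ^ (2 * a + 1) := by
      simpa using mul_eval_derivative_C_mul_X_pow 1 y (2 * a + 1)
    rw [hP]
    simp only [derivative_add, derivative_sub, derivative_one, derivative_C_mul (a := π),
      derivative_sum, eval_add, eval_sub, eval_C_mul, eval_finsetSum, eval_zero]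
    rw [mul_add, mul_sub, h1, mul_left_comm, Finset.mul_sum]
    simp only [mul_eval_derivative_C_mul_X_pow]
    rw [hρ1]; ring
  have hmon2 : ∀ (c : O) (n : ℕ), y ^ 2 * (derivative (derivative (C c * X ^ n))).eval y =
      n * (n - 1) * c * y ^ n := by
    intro c n
    rcases n with _ | _ | n
    · simp
    · simp
    · rw [derivative_C_mul_X_pow, derivative_C_mul_X_pow]
      simp only [eval_mul, eval_C, eval_pow, eval_X, Nat.add_sub_cancel]
      push_cast
      ring
  have hθ2P : y ^ 2 * (derivative (derivative P)).eval y =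
      (2 * a + 1) * (2 * a) * y ^ (2 * a + 1) + π * ρ2 := by
    have h1 : y ^ 2 * (derivative (derivative (X ^ (2 * a + 1) : O[X]))).eval y =
        (2 * a + 1) * (2 * a) * y ^ (2 * a + 1) := by
      simpa using hmon2 1 (2 * a + 1)
    rw [hP]
    simp only [derivative_add, derivative_sub, derivative_one, derivative_C_mul (a := π),
      derivative_sum, eval_add, eval_sub, eval_C_mul, eval_finsetSum, eval_zero,
      derivative_zero]
    have h2 : y ^ 2 * (π * ∑ l ∈ Finset.range (2 * a + 1),
        (derivative (derivative (C (r l) * X ^ l))).eval y) = π * ρ2 := by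
      rw [hρ2, mul_left_comm, Finset.mul_sum]
      exact congrArg _ (Finset.sum_congr rfl fun l _ => hmon2 (r l) l)
    rw [mul_add, mul_sub, h1, h2]
    ring
  have hroot : 1 - y ^ (2 * a + 1) = π * ρ0 := by
    rw [hP] at hy
    simp only [eval_add, eval_sub, eval_mul, eval_C, eval_finsetSum, eval_pow, eval_X,
      eval_one] at hy
    rw [hρ0]
    linear_combination -hy
  -- The first-order error of X^a has coefficients l(m - l) r_l. The upper half l > a is folded down
  -- by y^(a+m-l) = y^m y^(a-l).
  have hF1 : y ^ a * (2 * a * ρ1 - ρ2) = A + y ^ (2 * a + 1) *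
      ∑ l ∈ Finset.Icc 1 a, (l : O) * (2 * a + 1 - l) * r (2 * a + 1 - l) * y ^ (a - l) := by
    rw [hρ1, hρ2, sum_range_two_mul_add_one, sum_range_two_mul_add_one, hA]
    simp only [Nat.cast_zero, zero_mul, zero_add, Finset.mul_sum]
    rw [← Finset.sum_sub_distrib, Finset.mul_sum, ← Finset.sum_add_distrib]
    refine Finset.sum_congr rfl fun l hl => ?_
    have hl := Finset.mem_Icc.mp hl
    have h1 : y ^ a * y ^ (2 * a + 1 - l) = y ^ (2 * a + 1) * y ^ (a - l) := by
      rw [← pow_add, ← pow_add]; congr 1; omega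
    rw [Nat.cast_sub (by omega), pow_add]
    push_cast
    linear_combination ((2 * a + 1 - l) * l * r (2 * a + 1 - l)) * h1
  set B := ∑ l ∈ Finset.Icc 1 a, (l : O) * (2 * a + 1 - l) * r (2 * a + 1 - l) * y ^ (a - l)
    with hB
  -- The leading operator on the correction yields -A - B, cancelling `hF1` up to multiples of 1 -
  -- y^m. The factor 2m in front of X^a keeps the correction free of denominators.
  have hF2 : y * (derivative (firstCorrection a r)).eval y - a * (firstCorrection a r).eval y =
      -A - B - 2 * a * (a + 1) * (a + 1) * r (a + 1) * y ^ (2 * a + 1) +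
        a * (a + 1) * r (a + 1) := by
    rw [mul_eval_derivative_firstCorrection, eval_firstCorrection]
    have : ∑ l ∈ Finset.Icc 1 a, (((a : O) - l) * (2 * a + 1 - l) * r (2 * a + 1 - l) * y ^ (a - l)
        - (a + l) * (2 * a + 1 - l) * r l * y ^ (a + l)) -
        a * ∑ l ∈ Finset.Icc 1 a, ((2 * (a : O) + 1 - l) * r (2 * a + 1 - l) * y ^ (a - l) -
        (2 * a + 1 - l) * r l * y ^ (a + l)) = -A - B := by
      rw [hA, hB, Finset.mul_sum, ← Finset.sum_sub_distrib, ← Finset.sum_neg_distrib,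
        ← Finset.sum_sub_distrib]
      exact Finset.sum_congr rfl fun l _ => by ring
    linear_combination this
  have hc1 := coeff_firstCorrection a r
  have hW1 := mul_eval_derivative_C_mul_X_pow (2 * (2 * (a : O) + 1)) y a
  set H := (firstCorrection a r).eval y
  set Θ := (derivative (firstCorrection a r)).eval y
  set p1 := (derivative P).eval y
  set p2 := (derivative (derivative P)).eval y
  set w := (derivative (C (2 * (2 * (a : O) + 1)) * X ^ a)).eval y
  have hXa : (X ^ a : O[X]).coeff (2 * a + 1) = 0 := by
    rw [coeff_X_pow, if_neg (by omega)]
  subst hh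
  simp only [derivative_add, eval_add, derivative_C_mul (a := π), derivative_C_mul (a := π ^ 2),
    eval_C_mul, eval_pow, eval_X, coeff_add, coeff_C_mul, hXa, hc1]
  set c2 := g.coeff (2 * a + 1)
  set g0 := g.eval y
  set g1 := (derivative g).eval y
  set z := y ^ (2 * a + 1)
  set X0 := y ^ a
  -- The cofactor collects all terms of order π^3 and π^4.
  refine ⟨2 * (y * g1) * ρ1 - g0 * ρ2 + 2 * a * (a + 1) * r (a + 1) * ρ1 ^ 2 -
    2 * c2 * (2 * a + 1) * z * ρ1 - π * c2 * ρ1 ^ 2, ?_⟩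
  have e1 : y ^ 2 * (2 * (w + π * Θ + π ^ 2 * g1) * p1 -
      (2 * (2 * a + 1) * X0 + π * H + π ^ 2 * g0) * p2 -
      (2 * (2 * a + 1) * 0 + π * -(2 * a * (a + 1) * r (a + 1)) + π ^ 2 * c2) * p1 ^ 2) =
      2 * (a * (2 * (2 * a + 1)) * X0 + π * (y * Θ) + π ^ 2 * (y * g1)) *
        ((2 * a + 1) * z + π * ρ1) -
      (2 * (2 * a + 1) * X0 + π * H + π ^ 2 * g0) * ((2 * a + 1) * (2 * a) * z + π * ρ2) -
      (π * -(2 * a * (a + 1) * r (a + 1)) + π ^ 2 * c2) * ((2 * a + 1) * z + π * ρ1) ^ 2 := by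
    rw [← hθP, ← hθ2P, ← hW1]
    ring
  rw [e1]
  linear_combination 2 * (2 * (a : O) + 1) * π * hF1 + 2 * (2 * a + 1) * z * π * hF2 +
    π * (2 * (2 * a + 1) * (A + a * (a + 1) * r (a + 1) * z)) * hroot

end

/-! ### The second-order obstruction and the determinant -/

section

variable {O ι : Type*} [CommRing O] {π : O} {a : ℕ} {x : ι → O}

/-- The second-order obstruction to annihilating the Cayley operator is a multiple of `r a`. -/
theorem second_order_mem_solvableModulo
    (hu : ∀ k : ℕ, 0 < k → k ≤ 2 * a + 1 → IsUnit (k : O))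
    (ha : 0 < a) (hx : ∀ i, π ∣ x i ^ (2 * a + 1) - 1) (r : ℕ → O) :
    ∃ t : O, ((fun i => 2 * (2 * a + 1) *
          (∑ l ∈ Finset.Icc 1 a, l * (2 * a + 1 - l) * r l * x i ^ (a + l) +
            a * (a + 1) * r (a + 1) * x i ^ (2 * a + 1)) *
          ∑ l ∈ Finset.range (2 * a + 1), r l * x i ^ l +
        2 * (x i * (derivative (firstCorrection a r)).eval (x i)) *
          ∑ l ∈ Finset.range (2 * a + 1), l * r l * x i ^ l -
        (firstCorrection a r).eval (x i) *
          ∑ l ∈ Finset.range (2 * a + 1), l * (l - 1) * r l * x i ^ l +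
        4 * a * (a + 1) * r (a + 1) * (2 * a + 1) * (x i ^ (2 * a + 1) *
          ∑ l ∈ Finset.range (2 * a + 1), l * r l * x i ^ l), r a * t) : (ι → O) × O) ∈
      solvableModulo π a x := by
  have hQ := fun (γ : ℕ → O) (j l₀ : ℕ) (h1 : l₀ < 2 * a + 1)
    (h2 : j + l₀ = a ∨ j + l₀ = a + (2 * a + 1)) =>
    pow_mul_sum_mem_solvableModulo hu ha hx γ h1 h2
  let M := solvableModulo π a x
  let ρ0 : ι → O := fun i => ∑ l ∈ Finset.range (2 * a + 1), r l * x i ^ l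
  let ρ1 : ι → O := fun i => ∑ l ∈ Finset.range (2 * a + 1), (l : O) * r l * x i ^ l
  let ρ2 : ι → O := fun i => ∑ l ∈ Finset.range (2 * a + 1), (l : O) * (l - 1) * r l * x i ^ l
  have hE : ∀ j l₀ : ℕ, l₀ < 2 * a + 1 → (j + l₀ = a ∨ j + l₀ = a + (2 * a + 1)) →
      ((fun i => x i ^ j * (2 * j * ρ1 i - ρ2 i), l₀ * (2 * j - l₀ + 1) * r l₀) :
        (ι → O) × O) ∈ M := fun j l₀ h1 h2 => by
    convert hQ (fun k => k * (2 * j - k + 1) * r k) j l₀ h1 h2 using 2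
    ext i
    simp only [ρ1, ρ2, Finset.mul_sum, ← Finset.sum_sub_distrib]
    exact Finset.sum_congr rfl fun l _ => by ring
  -- The three contributions to the coefficient of r_l r_(m-l) add up to 3l(m-l) times (m-l) - (m-l)
  -- = 0. Only the boundary terms of the correction, multiples of r_(a+1), then contribute, and each
  -- of them meets r_a.
  have hterm : ∀ l ∈ Finset.Icc 1 a, ((fun i => 2 * (2 * a + 1) * l * (2 * a + 1 - l) * r l *
      (x i ^ (a + l) * ρ0 i) + (2 * a + 1 - l) * r (2 * a + 1 - l) *
      (x i ^ (a - l) * (2 * (a - l) * ρ1 i - ρ2 i)) - (2 * a + 1 - l) * r l *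
      (x i ^ (a + l) * (2 * (a + l) * ρ1 i - ρ2 i)), 0) : (ι → O) × O) ∈ M := fun l hl => by
    have hl := Finset.mem_Icc.mp hl
    have h1 := M.smul_mem (2 * (2 * a + 1) * l * (2 * a + 1 - l) * r l)
      (hQ r (a + l) (2 * a + 1 - l) (by omega) (by omega))
    have h2 := M.smul_mem ((2 * a + 1 - l) * r (2 * a + 1 - l))
      (hE (a - l) l (by omega) (by omega))
    have h3 := M.smul_mem ((2 * a + 1 - l) * r l)
      (hE (a + l) (2 * a + 1 - l) (by omega) (by omega))
    convert M.sub_mem (M.add_mem h1 h2) h3 using 1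
    simp only [Prod.smul_mk, Prod.mk_add_mk, Prod.mk_sub_mk, Prod.mk.injEq, smul_eq_mul]
    rw [Nat.cast_sub hl.2, Nat.cast_sub (by omega : l ≤ 2 * a + 1)]
    push_cast
    exact ⟨rfl, by ring⟩
  have h1 := M.sum_mem hterm
  have h2 := M.smul_mem (2 * (2 * a + 1) * (a * (a + 1)) * r (a + 1))
    (hQ r (2 * a + 1) a (by omega) (by omega))
  have h3 := M.smul_mem ((a + 1) * r (a + 1)) (hE 0 a (by omega) (by omega))
  have h4 := M.smul_mem (2 * a * (a + 1) * r (a + 1)) (hE (2 * a + 1) a (by omega) (by omega))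
  have h5 := M.smul_mem (4 * a * (a + 1) * r (a + 1) * (2 * a + 1))
    (hQ (fun k => k * r k) (2 * a + 1) a (by omega) (by omega))
  refine ⟨2 * (2 * a + 1) * (a * (a + 1)) * r (a + 1) - (a + 1) * r (a + 1) * (a * (-a + 1)) -
    2 * a * (a + 1) * r (a + 1) * (a * (2 * (2 * a + 1) - a + 1)) +
    4 * a * (a + 1) * r (a + 1) * (2 * a + 1) * a, ?_⟩
  convert M.add_mem (M.sub_mem (M.sub_mem (M.add_mem h1 h2) h3) h4) h5 using 1
  ext i
  · simp only [Prod.smul_mk, Prod.fst_add, Prod.fst_sub, Prod.fst_sum, Pi.add_apply,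
      Pi.sub_apply, Finset.sum_apply, Pi.smul_apply, smul_eq_mul,
      mul_eval_derivative_firstCorrection, eval_firstCorrection]
    change _ * _ * ρ0 i + _ * ρ1 i - _ * ρ2 i + _ * (_ * ρ1 i) =
      _ + _ * (_ * ρ0 i) - _ - _ + _ * (_ * ρ1 i)
    have hsum : ∀ (f g h : ℕ → O) (u v w : O),
        2 * (2 * (a : O) + 1) * (∑ l ∈ Finset.Icc 1 a, f l) * u +
        2 * (∑ l ∈ Finset.Icc 1 a, g l) * v - (∑ l ∈ Finset.Icc 1 a, h l) * w =
        ∑ l ∈ Finset.Icc 1 a,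
          (2 * (2 * (a : O) + 1) * f l * u + 2 * g l * v - h l * w) := fun f g h u v w => by
      rw [Finset.sum_sub_distrib, Finset.sum_add_distrib, Finset.mul_sum, Finset.mul_sum,
        Finset.sum_mul, Finset.sum_mul, Finset.sum_mul]
    have key := (hsum (fun l => l * (2 * a + 1 - l) * r l * x i ^ (a + l))
      (fun l => (a - l) * (2 * a + 1 - l) * r (2 * a + 1 - l) * x i ^ (a - l) -
        (a + l) * (2 * a + 1 - l) * r l * x i ^ (a + l))
      (fun l => (2 * a + 1 - l) * r (2 * a + 1 - l) * x i ^ (a - l) -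
        (2 * a + 1 - l) * r l * x i ^ (a + l)) (ρ0 i) (ρ1 i) (ρ2 i)).trans
      (Finset.sum_congr rfl fun l _ => (by ring : _ =
      2 * (2 * a + 1) * l * (2 * a + 1 - l) * r l *
      (x i ^ (a + l) * ρ0 i) + (2 * a + 1 - l) * r (2 * a + 1 - l) *
      (x i ^ (a - l) * (2 * (a - l) * ρ1 i - ρ2 i)) - (2 * a + 1 - l) * r l *
      (x i ^ (a + l) * (2 * (a + l) * ρ1 i - ρ2 i))))
    push_cast
    linear_combination key
  · simp only [Prod.smul_mk, Prod.snd_add, Prod.snd_sub, Prod.snd_sum, smul_eq_mul,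
      Finset.sum_const_zero]
    push_cast
    ring

theorem eval_monomial_sum (b : ℕ → O) (n : ℕ) (y : O) :
    y * (derivative (∑ j ∈ Finset.range (n + 1), C (b j) * X ^ j)).eval y =
      ∑ j ∈ Finset.range (n + 1), j * b j * y ^ j := by
  simp only [derivative_sum, eval_finsetSum, Finset.mul_sum, mul_eval_derivative_C_mul_X_pow]

/-- If the nodes are the roots of a polynomial congruent to `X ^ m - 1` modulo `π`, where
`m = 2 a + 1`, then the determinant of the Cayley type matrix is divisible by `π ^ 2`, and even by
`π ^ 3` when the coefficient `r a` of the perturbation is divisible by `π`. -/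
theorem pow_dvd_det_of_nodal_eq [IsDomain O] [IsLocalRing O] [Fintype ι] [DecidableEq ι]
    (hπ : ¬IsUnit π) (hcard : Fintype.card ι = 2 * a + 1)
    (hu : ∀ k : ℕ, 0 < k → k ≤ 2 * a + 1 → IsUnit (k : O)) (ha : 0 < a)
    (hx0 : ∀ i, IsUnit (x i)) (hx : ∀ i j, i ≠ j → IsUnit (x i - x j)) {r : ℕ → O}
    (hP : Lagrange.nodal Finset.univ x =
      X ^ (2 * a + 1) - 1 + C π * ∑ l ∈ Finset.range (2 * a + 1), C (r l) * X ^ l)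
    {A : Matrix ι ι O} (hA1 : ∀ i, A i i = 1)
    (hA : ∀ i j, i ≠ j → A i j * (x i - x j) = x i + x j) :
    π ^ 2 ∣ A.det ∧ (π ∣ r a → π ^ 3 ∣ A.det) := by
  have hroot : ∀ i, (Lagrange.nodal Finset.univ x).eval (x i) = 0 := fun i =>
    Lagrange.eval_nodal_at_node (Finset.mem_univ i)
  have hx1 : ∀ i, π ∣ x i ^ (2 * a + 1) - 1 := fun i => by
    have h := hroot i
    rw [hP] at h
    simp only [eval_add, eval_sub, eval_pow, eval_X, eval_one, eval_C_mul] at h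
    exact ⟨-_, by rw [eq_neg_of_add_eq_zero_left h, mul_neg]⟩
  have : Nonempty ι := Fintype.card_pos_iff.mp (by omega)
  obtain ⟨i₀⟩ := this
  have h2 : IsUnit (2 : O) := by exact_mod_cast hu 2 (by omega) (by omega)
  have hm : IsUnit (2 * (a : O) + 1) := by exact_mod_cast hu (2 * a + 1) (by omega) le_rfl
  have main : ∀ (g : O[X]) (d : O), g.natDegree ≤ 2 * a + 1 → g.eval 0 = 0 → d ∣ π ^ 3 →
      (∀ i, d ∣ π ^ 2 * ((2 * (2 * a + 1) *
          (∑ l ∈ Finset.Icc 1 a, l * (2 * a + 1 - l) * r l * x i ^ (a + l) +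
            a * (a + 1) * r (a + 1) * x i ^ (2 * a + 1)) *
          ∑ l ∈ Finset.range (2 * a + 1), r l * x i ^ l +
        2 * (x i * (derivative (firstCorrection a r)).eval (x i)) *
          ∑ l ∈ Finset.range (2 * a + 1), l * r l * x i ^ l -
        (firstCorrection a r).eval (x i) *
          ∑ l ∈ Finset.range (2 * a + 1), l * (l - 1) * r l * x i ^ l +
        4 * a * (a + 1) * r (a + 1) * (2 * a + 1) * (x i ^ (2 * a + 1) *
          ∑ l ∈ Finset.range (2 * a + 1), l * r l * x i ^ l)) +
        (2 * a + 1) * (2 * (x i * (derivative g).eval (x i)) - 2 * a * g.eval (x i)) *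
          x i ^ (2 * a + 1) - g.coeff (2 * a + 1) * (2 * a + 1) ^ 2 * (x i ^ (2 * a + 1)) ^ 2)) →
      d ∣ A.det := fun g d hg hg0 hd hdvd => by
    refine dvd_det_of_dvd_interpolation hx0 hx (h := C (2 * (2 * (a : O) + 1)) * X ^ a +
      C π * firstCorrection a r + C (π ^ 2) * g) ?_ ?_ hA1 hA ?_ (i₀ := i₀) ?_
    · rw [hcard]
      refine (natDegree_add_le _ _).trans (max_le ((natDegree_add_le _ _).trans (max_le ?_ ?_)) ?_)
      · exact (natDegree_C_mul_X_pow_le _ _).trans (by omega)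
      · exact (natDegree_C_mul_le _ _).trans (natDegree_firstCorrection_le a r)
      · exact (natDegree_C_mul_le _ _).trans hg
    · simp only [eval_add, eval_C_mul, eval_zero_firstCorrection ha, hg0, eval_pow, eval_X,
        zero_pow ha.ne']
      ring
    · intro i
      rw [hcard]
      have := cayley_operator_expansion r (g := g) hP rfl ha (hroot i)
      exact (dvd_iff_dvd_of_dvd_sub (hd.trans this)).mpr (hdvd i)
    -- The value is the unit 2m x^a plus a multiple of the nonunit π, hence a unit in the local
    -- ring.
    · simp only [eval_add, eval_C_mul, eval_pow, eval_X]
      have hlead : IsUnit (2 * (2 * (a : O) + 1) * x i₀ ^ a) := (h2.mul hm).mul ((hx0 i₀).pow a)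
      by_contra hn
      have hsum : IsUnit ((2 * (2 * (a : O) + 1) * x i₀ ^ a + π * (firstCorrection a r).eval (x i₀)
          + π ^ 2 * g.eval (x i₀)) +
          π * (-((firstCorrection a r).eval (x i₀) + π * g.eval (x i₀)))) := by
        convert hlead using 1
        ring
      rcases IsLocalRing.isUnit_or_isUnit_of_isUnit_add hsum with h | h
      · exact hn h
      · exact hπ (isUnit_of_mul_isUnit_left h)
  constructor
  -- Without a second correction the error is already of order π^2.
  · exact main 0 (π ^ 2) (by simp) (by simp) (pow_dvd_pow _ (by norm_num))
      fun i => dvd_mul_right _ _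
  · intro hr
    obtain ⟨t, b, hb0, hb⟩ := second_order_mem_solvableModulo hu ha hx1 r
    refine main (∑ j ∈ Finset.range (2 * a + 1 + 1), C (b j) * X ^ j) (π ^ 3) ?_ ?_ dvd_rfl
      fun i => ?_
    · exact natDegree_sum_le_of_forall_le _ _ fun j hj =>
        (natDegree_C_mul_X_pow_le _ _).trans (Nat.lt_succ_iff.mp (Finset.mem_range.mp hj))
    · rw [eval_finsetSum]
      refine Finset.sum_eq_zero fun j _ => ?_
      rcases Nat.eq_zero_or_pos j with rfl | hj
      · simp [hb0]
      · simp [hj.ne']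
    · rw [pow_succ]
      refine mul_dvd_mul_left _ ?_
      have hc : (∑ j ∈ Finset.range (2 * a + 1 + 1), C (b j) * X ^ j : O[X]).coeff (2 * a + 1) =
          b (2 * a + 1) := by
        simp [coeff_C_mul, coeff_X_pow]
      rw [eval_monomial_sum, hc, eval_finsetSum]
      simp only [eval_C_mul, eval_pow, eval_X]
      rw [Finset.sum_range_succ fun j => (j : O) * b j * x i ^ j,
        Finset.sum_range_succ fun j => b j * x i ^ j]
      have h1 := (dvd_iff_dvd_of_dvd_sub (hb i)).mpr ((hr.mul_right t).mul_right (x i ^ a))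
      have hS : ∑ j ∈ Finset.range (2 * a + 1), 2 * (2 * (a : O) + 1) * ((j : O) - a) * b j * x i ^ j
          = (2 * a + 1) * (2 * ∑ j ∈ Finset.range (2 * a + 1), j * b j * x i ^ j -
            2 * a * ∑ j ∈ Finset.range (2 * a + 1), b j * x i ^ j) := by
        rw [Finset.mul_sum, Finset.mul_sum, ← Finset.sum_sub_distrib, Finset.mul_sum]
        exact Finset.sum_congr rfl fun j _ => by ring
      rw [hS] at h1
      dsimp only at h1
      set S1 := ∑ j ∈ Finset.range (2 * a + 1), (j : O) * b j * x i ^ j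
      set S0 := ∑ j ∈ Finset.range (2 * a + 1), b j * x i ^ j
      obtain ⟨c, hc⟩ := h1
      obtain ⟨d, hd⟩ := hx1 i
      -- The d-terms replace x^m by 1 modulo π, both in the factor x^m and in (x^m)^2.
      refine ⟨c + d * ((2 * a + 1) * (2 * S1 - 2 * a * S0) +
        (2 * a + 1) * b (2 * a + 1) * (x i ^ (2 * a + 1) + 1)), ?_⟩
      push_cast
      linear_combination hc + ((2 * a + 1) * (2 * S1 - 2 * a * S0) +
        (2 * a + 1) * b (2 * a + 1) * (x i ^ (2 * a + 1) + 1)) * hd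

end

/-! ### Half-range power sums -/

/-- An even number 2j up to 2m is either at most m, or 2m + 1 minus an odd number at most m. -/
theorem sum_two_mul_eq_sum_ite {M : Type*} [AddCommMonoid M] (m : ℕ) (f : ℕ → M) :
    ∑ j ∈ Finset.Icc 1 m, f (2 * j) =
      ∑ j ∈ Finset.Icc 1 m, if j % 2 = 0 then f j else f (2 * m + 1 - j) := by
  refine Finset.sum_nbij' (fun j => if 2 * j ≤ m then 2 * j else 2 * m + 1 - 2 * j)
    (fun k => if k % 2 = 0 then k / 2 else (2 * m + 1 - k) / 2) ?_ ?_ ?_ ?_ ?_ <;>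
    intro j hj <;> simp only [Finset.mem_Icc] at hj ⊢
  · split_ifs <;> omega
  · split_ifs <;> omega
  · split_ifs <;> omega
  · split_ifs <;> omega
  · split_ifs with h1 h2 h3
    · rfl
    · omega
    · omega
    · congr 1; omega

theorem ZMod.two_pow_half_eq_one {p : ℕ} [Fact p.Prime] (hp8 : p % 8 = 7) :
    (2 : ZMod p) ^ (p / 2) = 1 := by
  have hp2 : p ≠ 2 := by rintro rfl; omega
  have h2 : (2 : ZMod p) ≠ 0 := by
    intro h
    have : ((2 : ℕ) : ZMod p) = 0 := by exact_mod_cast h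
    rw [ZMod.natCast_eq_zero_iff] at this
    have := Nat.le_of_dvd (by norm_num) this
    omega
  exact (ZMod.euler_criterion p h2).mp ((ZMod.exists_sq_eq_two_iff hp2).mpr (Or.inr hp8))

/-- Doubling preserves j^m because 2^m = 1, while folding p - j back to j flips the sign as m is
odd. Hence the full sum equals itself minus twice the odd part. -/
theorem ZMod.sum_odd_pow_half_eq_zero {p m : ℕ} [Fact p.Prime] (hp8 : p % 8 = 7)
    (hm : p = 2 * m + 1) :
    ∑ j ∈ Finset.Icc 1 m, (if j % 2 = 0 then 0 else (j : ZMod p) ^ m) = 0 := by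
  have hm2 : p / 2 = m := by omega
  have h2m := ZMod.two_pow_half_eq_one hp8
  have hodd : Odd m := Nat.odd_iff.mpr (by omega)
  rw [hm2] at h2m
  have h := sum_two_mul_eq_sum_ite m fun j => (j : ZMod p) ^ m
  simp only [Nat.cast_mul, Nat.cast_ofNat, mul_pow, h2m, one_mul] at h
  have h1 : ∀ j ∈ Finset.Icc 1 m, (if j % 2 = 0 then (j : ZMod p) ^ m
      else ((2 * m + 1 - j : ℕ) : ZMod p) ^ m) =
      (j : ZMod p) ^ m - 2 * (if j % 2 = 0 then 0 else (j : ZMod p) ^ m) := fun j hj => by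
    have hj := Finset.mem_Icc.mp hj
    split_ifs
    · ring
    · rw [← hm, Nat.cast_sub (by omega), ZMod.natCast_self, zero_sub, hodd.neg_pow]
      ring
  rw [Finset.sum_congr rfl h1, Finset.sum_sub_distrib, ← Finset.mul_sum] at h
  have h2 : (2 : ZMod p) ≠ 0 := fun h0 => by
    rw [h0, zero_pow (by omega)] at h2m
    exact zero_ne_one h2m
  have h3 : 2 * ∑ j ∈ Finset.Icc 1 m, (if j % 2 = 0 then 0 else (j : ZMod p) ^ m) = 0 := by
    linear_combination h
  exact (mul_eq_zero.mp h3).resolve_left h2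

/-- Half-range power sums of suitable even exponents vanish modulo `p ^ 2` if `p ≡ 7 (mod 8)`. -/
theorem sq_dvd_sum_Icc_pow {p m n : ℕ} [Fact p.Prime] (hp8 : p % 8 = 7) (hm : p = 2 * m + 1)
    (hpow : ∀ z : ZMod p, z ^ n = z ^ m) (hn : Odd n) :
    (p : ℤ) ^ 2 ∣ ∑ j ∈ Finset.Icc 1 m, (j : ℤ) ^ (n + 1) := by
  have heven : Even (n + 1) := hn.add_one
  set S := ∑ j ∈ Finset.Icc 1 m, (if j % 2 = 0 then 0 else (j : ℤ) ^ n) with hS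
  have hpS : (p : ℤ) ∣ S := by
    rw [← ZMod.intCast_zmod_eq_zero_iff_dvd, hS, ← ZMod.sum_odd_pow_half_eq_zero hp8 hm]
    push_cast
    simp only [hpow]
  have h := sum_two_mul_eq_sum_ite m fun j => (j : ℤ) ^ (n + 1)
  simp only [Nat.cast_mul, Nat.cast_ofNat, mul_pow, ← Finset.mul_sum] at h
  have hred : (p : ℤ) ^ 2 ∣ ∑ j ∈ Finset.Icc 1 m, (if j % 2 = 0 then (j : ℤ) ^ (n + 1)
      else ((2 * m + 1 - j : ℕ) : ℤ) ^ (n + 1)) -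
      (∑ j ∈ Finset.Icc 1 m, (j : ℤ) ^ (n + 1) - (n + 1) * p * S) := by
    rw [hS, Finset.mul_sum, ← Finset.sum_sub_distrib, ← Finset.sum_sub_distrib]
    refine Finset.dvd_sum fun j hj => ?_
    have hj := Finset.mem_Icc.mp hj
    split_ifs
    · simp
    -- Binomial expansion mod p^2: (p - j)^(n+1) ≡ j^(n+1) - (n+1) p j^n.
    · obtain ⟨k, hk⟩ := Polynomial.powAddExpansion (-(j : ℤ)) (p : ℤ) (n + 1)
      rw [← hm, Nat.cast_sub (by omega), sub_eq_neg_add (p : ℤ) j, hk, heven.neg_pow, Nat.add_sub_cancel,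
        hn.neg_pow]
      exact ⟨k, by push_cast; ring⟩
  -- Here 2^n ≡ 2^m ≡ 1, so 2^(n+1) - 1 ≡ 1 mod p.
  have h2n : IsCoprime ((p : ℤ) ^ 2) (2 ^ (n + 1) - 1) := by
    refine IsCoprime.pow_left ?_
    rw [Prime.coprime_iff_not_dvd (Nat.prime_iff_prime_int.mp Fact.out)]
    intro hd
    have := (ZMod.intCast_zmod_eq_zero_iff_dvd _ p).mpr hd
    push_cast at this
    rw [pow_succ, hpow, ← (by omega : p / 2 = m), ZMod.two_pow_half_eq_one hp8] at this
    norm_num at this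
  refine h2n.dvd_of_dvd_mul_left ?_
  rw [← h] at hred
  have h3 : (p : ℤ) ^ 2 ∣ (n + 1) * p * S := by
    rw [sq, mul_assoc]
    exact Dvd.dvd.mul_left (mul_dvd_mul_left _ hpS) _
  convert dvd_sub hred h3 using 1
  ring

theorem ZMod.sum_univ_eq_sum_range {p : ℕ} [NeZero p] {M : Type*} [AddCommMonoid M]
    (f : ZMod p → M) : ∑ z, f z = ∑ k ∈ Finset.range p, f k := by
  refine Finset.sum_nbij' ZMod.val (fun k => (k : ZMod p)) ?_ ?_ ?_ ?_ ?_
  · exact fun z _ => Finset.mem_range.mpr z.val_lt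
  · simp
  · simp
  · exact fun k hk => ZMod.val_cast_of_lt (Finset.mem_range.mp hk)
  · simp

/-- For even n, j and p - j contribute equally, so twice this is the power sum over the whole field.
-/
theorem ZMod.sum_Icc_half_pow_eq_zero {p m n : ℕ} [Fact p.Prime] (hm : p = 2 * m + 1)
    (hn : Even n) (h0 : 0 < n) (hlt : n < p - 1) :
    ∑ j ∈ Finset.Icc 1 m, (j : ZMod p) ^ n = 0 := by
  have h1 := FiniteField.sum_pow_lt_card_sub_one (ZMod p) n (by rwa [ZMod.card])
  rw [ZMod.sum_univ_eq_sum_range] at h1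
  have h2 : ∑ k ∈ Finset.range p, (k : ZMod p) ^ n = ∑ k ∈ Finset.range (2 * m + 1),
    (k : ZMod p) ^ n := by rw [← hm]
  rw [h2, sum_range_two_mul_add_one, Nat.cast_zero, zero_pow h0.ne', zero_add] at h1
  have h3 : ∀ j ∈ Finset.Icc 1 m, (j : ZMod p) ^ n + ((2 * m + 1 - j : ℕ) : ZMod p) ^ n =
      2 * (j : ZMod p) ^ n := fun j hj => by
    have hj := Finset.mem_Icc.mp hj
    rw [← hm, Nat.cast_sub (by omega), ZMod.natCast_self, zero_sub, hn.neg_pow]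
    ring
  rw [Finset.sum_congr rfl h3, ← Finset.mul_sum] at h1
  refine (mul_eq_zero.mp h1).resolve_left fun h => ?_
  have h' : ((2 : ℕ) : ZMod p) = 0 := by exact_mod_cast h
  rw [ZMod.natCast_eq_zero_iff] at h'
  have := Nat.le_of_dvd (by norm_num) h'
  omega

/-! ### The squares as p-adic nodes -/

section

variable {p : ℕ} [Fact p.Prime]

theorem PadicInt.natCast_dvd_iff_toZMod_eq_zero (z : ℤ_[p]) :
    (p : ℤ_[p]) ∣ z ↔ PadicInt.toZMod z = 0 := by
  rw [← RingHom.mem_ker, PadicInt.ker_toZMod, PadicInt.maximalIdeal_eq_span_p,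
    Ideal.mem_span_singleton]

theorem PadicInt.isUnit_iff_toZMod_ne_zero (z : ℤ_[p]) :
    IsUnit z ↔ PadicInt.toZMod z ≠ 0 := by
  rw [Ne, ← RingHom.mem_ker, PadicInt.ker_toZMod, IsLocalRing.mem_maximalIdeal, mem_nonunits_iff,
    not_not]

theorem ZMod.natCast_ne_zero_of_lt {k : ℕ} (h0 : 0 < k) (hk : k < p) : (k : ZMod p) ≠ 0 := by
  rw [Ne, ZMod.natCast_eq_zero_iff]
  exact fun h => (Nat.le_of_dvd h0 h).not_gt hk

/-- The squares `1 ^ 2, …, m ^ 2` as `p`-adic integers. -/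
noncomputable def squareNode (p : ℕ) [Fact p.Prime] {m : ℕ} (i : Fin m) : ℤ_[p] :=
  (((i : ℕ) + 1 : ℕ) : ℤ_[p]) ^ 2

theorem toZMod_squareNode {m : ℕ} (i : Fin m) :
    PadicInt.toZMod (squareNode p i) = (((i : ℕ) + 1 : ℕ) : ZMod p) ^ 2 := by
  rw [squareNode, map_pow, map_natCast]

theorem toZMod_squareNode_injective {m : ℕ} (hm : p = 2 * m + 1) :
    Function.Injective fun i : Fin m => PadicInt.toZMod (squareNode p i) := by
  intro i j hij
  simp only [toZMod_squareNode] at hij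
  rcases sq_eq_sq_iff_eq_or_eq_neg.mp hij with h | h
  · rw [ZMod.natCast_eq_natCast_iff] at h
    have := h.eq_of_lt_of_lt (by omega) (by omega)
    exact Fin.ext (by omega)
  · have h1 : (((i : ℕ) + 1 + ((j : ℕ) + 1) : ℕ) : ZMod p) = 0 := by
      rw [Nat.cast_add, h, neg_add_cancel]
    exact absurd h1 (ZMod.natCast_ne_zero_of_lt (by omega) (by omega))

/-- Modulo `p`, the nonzero squares are the roots of `X ^ m - 1`. -/
theorem exists_nodal_squareNode_eq {m : ℕ} (hm : p = 2 * m + 1) :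
    ∃ r : ℕ → ℤ_[p], Lagrange.nodal Finset.univ (squareNode p (m := m)) =
      X ^ m - 1 + C (p : ℤ_[p]) * ∑ l ∈ Finset.range m, C (r l) * X ^ l := by
  have hp := (Fact.out : p.Prime).two_le
  set P := Lagrange.nodal Finset.univ (squareNode p (m := m))
  set Q : ℤ_[p][X] := P - (X ^ m - 1) with hQ
  have hPm : P.Monic := Lagrange.nodal_monic
  have hPd : P.degree = m := by simp [P, Lagrange.degree_nodal]
  have hXd : (X ^ m - 1 : ℤ_[p][X]).degree = m := degree_X_pow_sub_C (by omega) 1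
  have hXm : (X ^ m - 1 : ℤ_[p][X]).Monic := monic_X_pow_sub_C 1 (by omega)
  have hQd : Q.degree < m := by
    have := degree_sub_lt_left (hPd.trans hXd.symm) hPm.ne_zero (by rw [hPm, hXm])
    rwa [hPd] at this
  -- Degree below m, yet m distinct roots mod p by Fermat.
  have hmap : Q.map PadicInt.toZMod = 0 := by
    refine eq_zero_of_degree_lt_of_eval_finset_eq_zero
      (Finset.univ.image fun i : Fin m => PadicInt.toZMod (squareNode p i)) ?_ ?_
    · rw [Finset.card_image_of_injective _ (toZMod_squareNode_injective hm), Finset.card_univ,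
        Fintype.card_fin]
      exact degree_map_le.trans_lt hQd
    · intro z hz
      obtain ⟨i, -, rfl⟩ := Finset.mem_image.mp hz
      have h1 : P.eval (squareNode p i) = 0 := Lagrange.eval_nodal_at_node (Finset.mem_univ i)
      rw [eval_map_apply, hQ, eval_sub, h1]
      simp only [eval_sub, eval_pow, eval_X, eval_one, map_sub, map_pow, map_one, map_zero,
        toZMod_squareNode]
      rw [← pow_mul, ← (by omega : p - 1 = 2 * m),
        ZMod.pow_card_sub_one_eq_one (ZMod.natCast_ne_zero_of_lt (by omega) (by omega))]
      ring
  have hdvd : ∀ l, (p : ℤ_[p]) ∣ Q.coeff l := fun l => by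
    rw [PadicInt.natCast_dvd_iff_toZMod_eq_zero, ← coeff_map, hmap, coeff_zero]
  choose r hr using hdvd
  refine ⟨r, ?_⟩
  have hQn : Q.natDegree < m := by
    rcases eq_or_ne Q 0 with h | h
    · rw [h, natDegree_zero]
      omega
    · exact (natDegree_lt_iff_degree_lt h).mpr hQd
  have hsum : C (p : ℤ_[p]) * ∑ l ∈ Finset.range m, C (r l) * X ^ l = Q := by
    rw [Finset.mul_sum]
    conv_rhs => rw [as_sum_range' Q m hQn]
    refine Finset.sum_congr rfl fun l _ => ?_
    rw [hr l, ← C_mul_X_pow_eq_monomial, C_mul, mul_assoc]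
  rw [hsum, hQ]
  ring

theorem sum_fin_succ_eq_sum_Icc {M : Type*} [AddCommMonoid M] (m : ℕ) (f : ℕ → M) :
    ∑ i : Fin m, f ((i : ℕ) + 1) = ∑ j ∈ Finset.Icc 1 m, f j := by
  rw [Fin.sum_univ_eq_sum_range fun i => f (i + 1)]
  refine Finset.sum_nbij' (· + 1) (· - 1) ?_ ?_ ?_ ?_ ?_ <;> intro j hj <;>
    simp only [Finset.mem_Icc, Finset.mem_range] at hj ⊢ <;> omega

/-- For `p ≡ 7 (mod 8)` the middle coefficient of the perturbation is divisible by `p`. -/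
theorem dvd_middle_coeff {a : ℕ} (hm : p = 2 * (2 * a + 1) + 1) (hp8 : p % 8 = 7) {r : ℕ → ℤ_[p]}
    (hr : Lagrange.nodal Finset.univ (squareNode p (m := 2 * a + 1)) =
      X ^ (2 * a + 1) - 1 + C (p : ℤ_[p]) * ∑ l ∈ Finset.range (2 * a + 1), C (r l) * X ^ l) :
    (p : ℤ_[p]) ∣ r a := by
  have hp0 : (p : ℤ_[p]) ≠ 0 := by exact_mod_cast (Fact.out : p.Prime).ne_zero
  have hfermat : ∀ z : ZMod p, z ^ (3 * (2 * a + 1)) = z ^ (2 * a + 1) := fun z => by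
    rw [(by omega : 3 * (2 * a + 1) = p + 2 * a), pow_add, ZMod.pow_card, ← pow_succ']
  have h1 := sq_dvd_sum_Icc_pow hp8 hm (n := 2 * a + 1) (fun _ => rfl) ⟨a, rfl⟩
  have h3 := sq_dvd_sum_Icc_pow hp8 hm hfermat ⟨3 * a + 1, by ring⟩
  have hcast : ∀ n : ℕ, (p : ℤ) ^ 2 ∣ ∑ j ∈ Finset.Icc 1 (2 * a + 1), (j : ℤ) ^ n →
      (p : ℤ_[p]) ^ 2 ∣ ∑ i : Fin (2 * a + 1), (((i : ℕ) + 1 : ℕ) : ℤ_[p]) ^ n := fun n h => by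
    have := map_dvd (Int.castRingHom ℤ_[p]) h
    rw [sum_fin_succ_eq_sum_Icc (2 * a + 1) fun j => (j : ℤ_[p]) ^ n]
    simpa using this
  have hroot : ∀ i : Fin (2 * a + 1), 1 - squareNode p i ^ (2 * a + 1) =
      p * ∑ l ∈ Finset.range (2 * a + 1), r l * squareNode p i ^ l := fun i => by
    have h : (Lagrange.nodal Finset.univ (squareNode p (m := 2 * a + 1))).eval (squareNode p i)
      = 0 := Lagrange.eval_nodal_at_node (Finset.mem_univ i)
    rw [hr] at h
    simp only [eval_add, eval_sub, eval_mul, eval_C, eval_finsetSum, eval_pow, eval_X,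
      eval_one] at h
    linear_combination -h
  -- Weighting by x^(a+1) isolates r_a: x^(a+1+l) sums to zero mod p over the nodes unless a + 1 + l
  -- = m.
  have hS : (p : ℤ_[p]) * ∑ i : Fin (2 * a + 1), squareNode p i ^ (a + 1) *
      ∑ l ∈ Finset.range (2 * a + 1), r l * squareNode p i ^ l =
      ∑ i : Fin (2 * a + 1), (((i : ℕ) + 1 : ℕ) : ℤ_[p]) ^ (2 * a + 1 + 1) -
      ∑ i : Fin (2 * a + 1), (((i : ℕ) + 1 : ℕ) : ℤ_[p]) ^ (3 * (2 * a + 1) + 1) := by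
    rw [Finset.mul_sum, ← Finset.sum_sub_distrib]
    refine Finset.sum_congr rfl fun i _ => ?_
    rw [mul_left_comm, ← hroot i, squareNode]
    ring
  have hdvd : (p : ℤ_[p]) ∣ ∑ i : Fin (2 * a + 1), squareNode p i ^ (a + 1) *
      ∑ l ∈ Finset.range (2 * a + 1), r l * squareNode p i ^ l := by
    have := dvd_sub (hcast _ h1) (hcast _ h3)
    rw [← hS, sq] at this
    exact (mul_dvd_mul_iff_left hp0).mp this
  rw [PadicInt.natCast_dvd_iff_toZMod_eq_zero] at hdvd ⊢
  have hpow : ∀ l ∈ Finset.range (2 * a + 1), l ≠ a →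
      ∑ i : Fin (2 * a + 1), (((i : ℕ) + 1 : ℕ) : ZMod p) ^ (2 * (a + 1 + l)) = 0 := by
    intro l hl hla
    have hl := Finset.mem_range.mp hl
    rw [sum_fin_succ_eq_sum_Icc (2 * a + 1) fun j => (j : ZMod p) ^ (2 * (a + 1 + l))]
    rcases lt_or_gt_of_ne hla with h | h
    · exact ZMod.sum_Icc_half_pow_eq_zero hm (even_two_mul _) (by omega) (by omega)
    -- The exponent exceeds p - 1 here; Fermat lowers it into the range of the vanishing lemma.
    · have h4 : ∀ z : ZMod p, z ^ (2 * (a + 1 + l)) = z ^ (2 * (l - a)) := fun z => by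
        rw [(by omega : 2 * (a + 1 + l) = p + (2 * (l - a) - 1)), pow_add, ZMod.pow_card,
          ← pow_succ']
        congr 1
        omega
      simp only [h4]
      exact ZMod.sum_Icc_half_pow_eq_zero hm (even_two_mul _) (by omega) (by omega)
  simp only [map_sum, map_mul, map_pow, toZMod_squareNode, Finset.mul_sum] at hdvd
  rw [Finset.sum_comm, Finset.sum_eq_single a] at hdvd
  · have h5 : ∀ i ∈ (Finset.univ : Finset (Fin (2 * a + 1))),
        ((((i : ℕ) + 1 : ℕ) : ZMod p) ^ 2) ^ (a + 1) *
        (PadicInt.toZMod (r a) * ((((i : ℕ) + 1 : ℕ) : ZMod p) ^ 2) ^ a) =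
        PadicInt.toZMod (r a) := fun i _ => by
      have h6 : (((i : ℕ) + 1 : ℕ) : ZMod p) ^ (p - 1) = 1 :=
        ZMod.pow_card_sub_one_eq_one (ZMod.natCast_ne_zero_of_lt (by omega) (by omega))
      rw [(by omega : p - 1 = 2 * (a + 1) + 2 * a), pow_add] at h6
      linear_combination PadicInt.toZMod (r a) * h6
    rw [Finset.sum_congr rfl h5, Finset.sum_const, Finset.card_univ, Fintype.card_fin,
      nsmul_eq_mul] at hdvd
    exact (mul_eq_zero.mp hdvd).resolve_left (ZMod.natCast_ne_zero_of_lt (by omega) (by omega))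
  · intro l hl hla
    have h5 := hpow l hl hla
    have h6 : ∀ i ∈ (Finset.univ : Finset (Fin (2 * a + 1))),
        ((((i : ℕ) + 1 : ℕ) : ZMod p) ^ 2) ^ (a + 1) *
        (PadicInt.toZMod (r l) * ((((i : ℕ) + 1 : ℕ) : ZMod p) ^ 2) ^ l) =
        PadicInt.toZMod (r l) * (((i : ℕ) + 1 : ℕ) : ZMod p) ^ (2 * (a + 1 + l)) :=
      fun i _ => by ring
    rw [Finset.sum_congr rfl h6, ← Finset.mul_sum, h5, mul_zero]
  · intro h
    exact absurd (Finset.mem_range.mpr (by omega)) h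

end

/-! ### Transfer from ℤ_p to the rational determinant -/

theorem theorem1p4 (p : ℕ) [Fact p.Prime] (hp3 : 3 < p) (hp4 : p ≡ 3 [MOD 4]) :
    PadicModEq p 2 (1 + halfCayleyMatrix p).det 0 ∧
      (p ≡ 7 [MOD 8] → PadicModEq p 3 (1 + halfCayleyMatrix p).det 0) := by
  have hp4' : p % 4 = 3 := hp4
  obtain ⟨a, ha⟩ : ∃ a, p = 2 * (2 * a + 1) + 1 := ⟨p / 4, by omega⟩
  have ha0 : 0 < a := by omega
  have hcard : (p - 1) / 2 = 2 * a + 1 := by omega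
  have hm : p = 2 * ((p - 1) / 2) + 1 := by omega
  have hx : ∀ i j : Fin ((p - 1) / 2), i ≠ j → IsUnit (squareNode p i - squareNode p j) :=
    fun i j hij => by
      rw [PadicInt.isUnit_iff_toZMod_ne_zero, map_sub, sub_ne_zero]
      exact fun h => hij (toZMod_squareNode_injective hm h)
  have hx0 : ∀ i : Fin ((p - 1) / 2), IsUnit (squareNode p i) := fun i => by
    rw [PadicInt.isUnit_iff_toZMod_ne_zero, toZMod_squareNode]
    exact pow_ne_zero _ (ZMod.natCast_ne_zero_of_lt (by omega) (by omega))
  have hu : ∀ k : ℕ, 0 < k → k ≤ 2 * a + 1 → IsUnit (k : ℤ_[p]) := fun k hk hk' => by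
    rw [PadicInt.isUnit_iff_toZMod_ne_zero, map_natCast]
    exact ZMod.natCast_ne_zero_of_lt hk (by omega)
  have hpu : ¬IsUnit (p : ℤ_[p]) := by
    rw [PadicInt.isUnit_iff_toZMod_ne_zero, map_natCast, ZMod.natCast_self]
    simp
  -- Differences of nodes are units, so the entries lift to ℤ_p and the determinant can be studied
  -- there.
  have hentry : ∀ i j : Fin ((p - 1) / 2), ∃ c : ℤ_[p], (i = j → c = 1) ∧
      (i ≠ j → c * (squareNode p i - squareNode p j) = squareNode p i + squareNode p j) :=
    fun i j => by
      by_cases hij : i = j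
      · exact ⟨1, fun _ => rfl, fun h => absurd hij h⟩
      · obtain ⟨w, hw⟩ := (hx i j hij).exists_left_inv
        exact ⟨(squareNode p i + squareNode p j) * w, fun h => absurd h hij,
          fun _ => by rw [mul_assoc, hw, mul_one]⟩
  choose c hc1 hc using hentry
  let A : Matrix (Fin ((p - 1) / 2)) (Fin ((p - 1) / 2)) ℤ_[p] := Matrix.of c
  have hA : A.map PadicInt.Coe.ringHom =
      (1 + halfCayleyMatrix p).map (Rat.castHom ℚ_[p]) := by
    ext i j
    change ((c i j : ℤ_[p]) : ℚ_[p]) = (((1 + halfCayleyMatrix p) i j : ℚ) : ℚ_[p])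
    by_cases hij : i = j
    · subst hij
      simp [hc1, halfCayleyMatrix]
    · have h1 := congrArg (fun z : ℤ_[p] => (z : ℚ_[p])) (hc i j hij)
      have h2 := (hx i j hij).ne_zero
      rw [Ne, ← PadicInt.coe_eq_zero] at h2
      simp only [squareNode, PadicInt.coe_mul, PadicInt.coe_sub, PadicInt.coe_add,
        PadicInt.coe_pow, PadicInt.coe_natCast] at h1 h2
      rw [← eq_div_iff h2] at h1
      rw [h1, Matrix.add_apply, Matrix.one_apply_ne hij, halfCayleyMatrix, Matrix.of_apply,
        if_neg hij]
      push_cast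
      ring
  have hdet : ((A.det : ℤ_[p]) : ℚ_[p]) = ((1 + halfCayleyMatrix p).det : ℚ_[p]) := by
    have h1 := RingHom.map_det PadicInt.Coe.ringHom A
    have h2 := RingHom.map_det (Rat.castHom ℚ_[p]) (1 + halfCayleyMatrix p)
    rw [RingHom.mapMatrix_apply] at h1 h2
    rw [hA, ← h2] at h1
    exact h1
  have hfinal : ∀ k, (p : ℤ_[p]) ^ k ∣ A.det → PadicModEq p k (1 + halfCayleyMatrix p).det 0 :=
    fun k hk => ⟨A.det, 0, hdet, by simp, by simpa using hk⟩
  obtain ⟨r, hr⟩ := exists_nodal_squareNode_eq hm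
  have hA1 : ∀ i, A i i = 1 := fun i => hc1 i i rfl
  have hAij : ∀ i j, i ≠ j → A i j * (squareNode p i - squareNode p j) =
    squareNode p i + squareNode p j := hc
  have key := pow_dvd_det_of_nodal_eq hpu (by rw [Fintype.card_fin, hcard]) hu ha0 hx0 hx
    (r := r) (by rw [hr, hcard]) hA1 hAij
  refine ⟨hfinal 2 key.1, fun hp8 => hfinal 3 (key.2 (dvd_middle_coeff ha hp8 ?_))⟩
  rw [← hcard]
  exact hr
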